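/- Let $n\ge 3$ and let $\gamma\subset\mathbb{C}$ be a simple closed polygon (an embedded closed polygonal curve) with $n$ vertices, oriented counterclockwise around the bounded region that it encloses. A (nondegenerate) triangle, with vertices labeled $(T_0,T_1,T_2)$ counterclockwise around the triangle, is called ungracefully inscribed in $\gamma$ if $T_0,T_1,T_2\in\gamma$ and the cyclic order in which the vertices occur along the oriented curve $\gamma$ is $T_2,T_1,T_0$, i.e. the clockwise order of the vertices of the triangle. An essential ungraceful loop for $\gamma$ is a continuous loop $s\mapsto (T_0(s),T_1(s),T_2(s))$, $s\in\mathbb{R}/\mathbb{Z}$, of triangles ungracefully inscribed in $\gamma$ such that, for each $k=0,1,2$, the loop $s\mapsto T_k(s)$ winds a nonzero number of times around $\gamma$ (i.e. has nonzero degree as a map $\mathbb{R}/\mathbb{Z}\to\gamma$). Then $\gamma$ has no essential ungraceful loop. -/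

import Mathlib

namespace Polygon

/-- The closed polygonal curve `γ : ℝ → ℂ` of a polygon with `n` vertices, of period `n`:
on `[k, k + 1]` it runs affinely from vertex `k mod n` to vertex `k + 1 mod n`. -/
noncomputable def param {n : ℕ} [NeZero n] (P : Polygon ℂ n) (t : ℝ) : ℂ :=
  P.edgePath ℝ (Fin.ofNat n (⌊t⌋ % (n : ℤ)).toNat) (Int.fract t)

/-- The polygon is embedded: its boundary curve is a Jordan loop. -/
def IsSimple {n : ℕ} [NeZero n] (P : Polygon ℂ n) : Prop :=
  Set.InjOn P.param (Set.Ico 0 (n : ℝ))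

/-- The boundary curve has winding number `m` about the point `z` (which is then off the curve):
`L` is a continuous branch of `log (γ t - z)` along the curve. -/
def HasWindingNumberAbout {n : ℕ} [NeZero n] (P : Polygon ℂ n) (z : ℂ) (m : ℤ) : Prop :=
  ∃ L : ℝ → ℂ, Continuous L ∧ (∀ t, Complex.exp (L t) = P.param t - z) ∧
    ∀ t, L (t + n) = L t + m * (2 * Real.pi * Complex.I)

/-- The boundary curve goes counterclockwise around the region that it bounds: it winds exactly
once, counterclockwise, about each point of the bounded part of its complement. -/
def IsCounterclockwise {n : ℕ} [NeZero n] (P : Polygon ℂ n) : Prop :=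
  ∀ z : ℂ, z ∉ Set.range P.param →
    Bornology.IsBounded (connectedComponentIn (Set.range P.param)ᶜ z) →
    P.HasWindingNumberAbout z 1

/-- The labeled points `T 0, T 1, T 2` are the vertices of a nondegenerate triangle, listed
counterclockwise around it. -/
def IsCounterclockwiseTriangle (T : Fin 3 → ℂ) : Prop :=
  0 < ((starRingEnd ℂ) (T 1 - T 0) * (T 2 - T 0)).im

/-- `T` is a counterclockwise labeled triangle with vertices on the polygon `P`, and a positive
turn along `P` meets its vertices in the cyclic order `T 2, T 1, T 0`, which is the clockwise
order of the vertices around the triangle. -/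
def IsUngracefullyInscribed {n : ℕ} [NeZero n] (P : Polygon ℂ n) (T : Fin 3 → ℂ) : Prop :=
  IsCounterclockwiseTriangle T ∧
    ∃ t : Fin 3 → ℝ, (∀ k, P.param (t k) = T k) ∧ t 2 < t 1 ∧ t 1 < t 0 ∧ t 0 < t 2 + n

/-- The loop `c` lies on the polygon `P` and winds `m` times around `P`, that is, it has degree `m`
as a map from the circle to the boundary curve: `τ` is a lift of `c` through `P.param`. -/
def WindsAround {n : ℕ} [NeZero n] (P : Polygon ℂ n) (c : UnitAddCircle → ℂ) (m : ℤ) : Prop :=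
  ∃ τ : ℝ → ℝ, Continuous τ ∧ (∀ s : ℝ, P.param (τ s) = c (s : UnitAddCircle)) ∧
    ∀ s, τ (s + 1) = τ s + m * n

/-- A continuous loop of labeled triangles ungracefully inscribed in `P`, each vertex of which
winds a nonzero number of times around `P`. -/
structure IsEssentialUngracefulLoop {n : ℕ} [NeZero n] (P : Polygon ℂ n)
    (T : UnitAddCircle → Fin 3 → ℂ) : Prop where
  continuous : Continuous T
  ungraceful : ∀ s, P.IsUngracefullyInscribed (T s)
  essential : ∀ k : Fin 3, ∃ m : ℤ, m ≠ 0 ∧ P.WindsAround (fun s => T s k) m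

end Polygon

/-! Lift the vertices to parameters `τ₂ < τ₁ < τ₀ < τ₂ + n` and follow the chord directions with one
continuous branch `Θ a b` of `log (γ b - γ a)`, defined for `a < b < a + n` (`exists_isChordLog`).
For a counterclockwise curve `Θ b (a + n) = Θ a b + π i` (`swap_of_isCounterclockwise`), so the
three turns between consecutive chords of the triangle add up to `2 π`. An ungraceful triangle is
run through clockwise, so each turn has negative sine. A positive turn then exceeds `π`, so the
three cannot all be positive, and a negative one stays negative along the loop. But its vertex,
having nonzero degree, passes through a lowest point of the curve, where the turn is nonnegative
(`im_le_im_of_forall_im_le`).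

The swap constant comes from comparing the winding numbers on the two sides of an edge
(`hasWindingNumberAbout_of_near`); the Jordan curve theorem is not needed. -/

open Complex Set in
/-- A continuous branch of the logarithm of a constant is constant on preconnected sets. -/
theorem Complex.eq_of_exp_eq_const {X : Type*} [TopologicalSpace X] {S : Set X}
    (hS : IsPreconnected S) {f : X → ℂ} (hf : ContinuousOn f S) {c : ℂ}
    (h : ∀ x ∈ S, exp (f x) = c) {x y : X} (hx : x ∈ S) (hy : y ∈ S) : f x = f y :=
  isCoveringMap_exp.isSeparatedMap.constOn_of_comp
    isCoveringMap_exp.isLocalHomeomorph.isLocallyInjective hS hf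
    (fun a ha b hb => Subtype.ext ((h a ha).trans (h b hb).symm)) hx hy

/-- Two continuous functions whose exponentials have constant ratio differ by a constant. -/
theorem Complex.sub_eq_sub_of_exp_eq_mul {X : Type*} [TopologicalSpace X] {S : Set X}
    (hS : IsPreconnected S) {f g : X → ℂ} (hf : ContinuousOn f S) (hg : ContinuousOn g S) {c : ℂ}
    (h : ∀ x ∈ S, exp (f x) = c * exp (g x)) {x y : X} (hx : x ∈ S) (hy : y ∈ S) :
    f x - g x = f y - g y :=
  eq_of_exp_eq_const hS (f := fun x => f x - g x) (hf.sub hg) (c := c)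
    (fun x hx => by rw [exp_sub, h x hx, mul_div_cancel_right₀ _ (exp_ne_zero _)]) hx hy

/-! ### The periodic parametrization. -/

namespace Polygon

variable {n : ℕ} [NeZero n] (P : Polygon ℂ n)

theorem finRotate_ofNat_emod (k : ℤ) :
    finRotate n (Fin.ofNat n (k % (n : ℤ)).toNat) = Fin.ofNat n ((k + 1) % (n : ℤ)).toNat := by
  have hn : (0 : ℤ) < n := by exact_mod_cast Nat.pos_of_ne_zero (NeZero.ne n)
  have h0 := Int.emod_nonneg k hn.ne'
  have h1 := Int.emod_nonneg (k + 1) hn.ne'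
  rw [finRotate_apply]
  apply Fin.ext
  rw [Fin.val_add]
  simp only [Fin.ofNat, Fin.val_one']
  zify
  rw [Int.toNat_of_nonneg h0, Int.toNat_of_nonneg h1]
  simp [Int.add_emod]

theorem param_intCast (k : ℤ) : P.param k = P (Fin.ofNat n (k % (n : ℤ)).toNat) := by
  simp [param, edgePath]

theorem param_add_n (t : ℝ) : P.param (t + n) = P.param t := by
  simp [param]

theorem param_add_int_mul (t : ℝ) (m : ℤ) : P.param (t + m * n) = P.param t := by
  have : ((m : ℝ) * n) = ((m * n : ℤ) : ℝ) := by push_cast; rfl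
  rw [param, param, this, Int.floor_add_intCast, Int.fract_add_intCast, Int.add_mul_emod_self_right]

/-- The right end is included although the floor jumps there; this is what lets the pieces glue
continuously. -/
theorem param_eq_lineMap (k : ℤ) {t : ℝ} (ht : t ∈ Set.Icc (k : ℝ) (k + 1)) :
    P.param t = AffineMap.lineMap (P.param k) (P.param (k + 1 : ℤ)) (t - k) := by
  rcases eq_or_lt_of_le ht.2 with h | h
  · have : t = ((k + 1 : ℤ) : ℝ) := by push_cast; exact h
    rw [h]
    push_cast
    simp
  · have hf : ⌊t⌋ = k := Int.floor_eq_iff.2 ⟨ht.1, h⟩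
    rw [P.param_intCast k, P.param_intCast (k + 1), ← finRotate_ofNat_emod, param, Int.fract, hf,
      edgePath]

theorem continuous_param : Continuous P.param := by
  have key : ∀ k : ℤ, ContinuousOn P.param (Set.Icc (k : ℝ) (k + 1)) := fun k =>
    ContinuousOn.congr (f := fun t : ℝ => AffineMap.lineMap (P.param k) (P.param (k + 1 : ℤ)) (t - k))
      (by simp only [AffineMap.lineMap_apply]; fun_prop) fun t ht => P.param_eq_lineMap k ht
  rw [continuous_iff_continuousAt]
  intro t
  -- The integer nearest to `t` is the common end of the two intervals, so `t` is interior to their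
  -- union even when it is itself an integer.
  have h := (key (⌊t + 1 / 2⌋ - 1)).union_of_isClosed (key ⌊t + 1 / 2⌋) isClosed_Icc isClosed_Icc
  have h1 := Int.floor_le (t + 1 / 2)
  have h2 := Int.lt_floor_add_one (t + 1 / 2)
  refine h.continuousAt (Filter.mem_of_superset (Ioo_mem_nhds (a := (⌊t + 1 / 2⌋ : ℝ) - 1)
    (b := (⌊t + 1 / 2⌋ : ℝ) + 1) (by linarith) (by linarith)) ?_)
  rintro x ⟨hx1, hx2⟩
  push_cast
  rcases le_total x ⌊t + 1 / 2⌋ with hx | hx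
  · exact Or.inl ⟨hx1.le, by linarith⟩
  · exact Or.inr ⟨hx, hx2.le⟩

variable {P}

theorem natCast_pos (n : ℕ) [NeZero n] : (0 : ℝ) < n :=
  Nat.cast_pos.2 (Nat.pos_of_ne_zero (NeZero.ne n))

theorem IsSimple.exists_eq_add (hP : P.IsSimple) {a b : ℝ} (h : P.param a = P.param b) :
    ∃ m : ℤ, b = a + m * n := by
  have hn := natCast_pos n
  have key : ∀ t, P.param (toIcoMod hn 0 t) = P.param t := fun t => by
    conv_rhs => rw [← toIcoMod_add_toIcoDiv_zsmul hn 0 t, zsmul_eq_mul, param_add_int_mul]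
  have hm : ∀ t, toIcoMod hn 0 t ∈ Set.Ico (0 : ℝ) n := fun t => by
    simpa using toIcoMod_mem_Ico hn 0 t
  have := hP (hm a) (hm b) (by rw [key, key, h])
  refine ⟨toIcoDiv hn 0 b - toIcoDiv hn 0 a, ?_⟩
  have ha := toIcoMod_add_toIcoDiv_zsmul hn 0 a
  have hb := toIcoMod_add_toIcoDiv_zsmul hn 0 b
  rw [zsmul_eq_mul] at ha hb
  push_cast
  linarith

theorem IsSimple.param_ne (hP : P.IsSimple) {a b : ℝ} (hab : a < b) (hb : b < a + n) :
    P.param a ≠ P.param b := by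
  intro h
  obtain ⟨m, hm⟩ := hP.exists_eq_add h
  have hn := natCast_pos n
  have h1 : (0 : ℝ) < m := by
    by_contra! h0
    nlinarith
  have h2 : (m : ℝ) < 1 := by
    by_contra! h0
    nlinarith
  have h3 : 0 < m := by exact_mod_cast h1
  have h4 : m < 1 := by exact_mod_cast h2
  omega

/-! ### Logarithms of chords. -/

/-- The pairs of parameters `a < b` that lie strictly within one turn along a polygon with
`n` vertices. -/
def paramPairs (n : ℕ) : Set (ℝ × ℝ) := {x | x.1 < x.2 ∧ x.2 < x.1 + n}

theorem convex_paramPairs (n : ℕ) : Convex ℝ (paramPairs n) := by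
  rintro ⟨a, b⟩ ⟨h1, h2⟩ ⟨c, d⟩ ⟨h3, h4⟩ u v hu hv huv
  simp only [paramPairs, Prod.smul_mk, Prod.mk_add_mk, smul_eq_mul, Set.mem_ofPred_eq] at *
  obtain rfl : v = 1 - u := by linarith
  rcases hu.eq_or_lt with rfl | hu
  · constructor <;> linarith
  · constructor <;> nlinarith

theorem isOpen_paramPairs (n : ℕ) : IsOpen (paramPairs n) :=
  (isOpen_lt continuous_fst continuous_snd).inter
    (isOpen_lt continuous_snd (continuous_fst.add continuous_const))

/-- `Θ` is a continuous branch of `log (γ b - γ a)`, the logarithm of the chords of the polygon. -/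
structure IsChordLog (P : Polygon ℂ n) (Θ : ℝ → ℝ → ℂ) : Prop where
  continuousOn : ContinuousOn (fun x : ℝ × ℝ => Θ x.1 x.2) (paramPairs n)
  exp_eq : ∀ {a b : ℝ}, a < b → b < a + n → Complex.exp (Θ a b) = P.param b - P.param a

/-- The parameter strip is convex, hence simply connected, and chords of a simple polygon do not
vanish on it. -/
theorem IsSimple.exists_isChordLog (hP : P.IsSimple) : ∃ Θ, P.IsChordLog Θ := by
  have hn := natCast_pos n
  have hne : (paramPairs n).Nonempty := ⟨(0, n / 2), by constructor <;> simp only <;> linarith⟩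
  have : ContractibleSpace (paramPairs n) := (convex_paramPairs n).contractibleSpace hne
  have hs : IsSimplyConnected (paramPairs n) := SimplyConnectedSpace.ofContractible _
  obtain ⟨f, hf, hfe⟩ := Complex.exists_continuousOn_eqOn_exp_comp hs (isOpen_paramPairs n)
    (g := fun x => P.param x.2 - P.param x.1)
    ((P.continuous_param.comp continuous_snd).sub
      (P.continuous_param.comp continuous_fst)).continuousOn
    (by
      rintro ⟨x, hx, h0⟩
      exact hP.param_ne hx.1 hx.2 (sub_eq_zero.1 h0).symm)
  exact ⟨fun a b => f (a, b), hf, fun h1 h2 => hfe (x := (_, _)) ⟨h1, h2⟩⟩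

theorem IsChordLog.continuousOn_comp {Θ : ℝ → ℝ → ℂ} (hΘ : P.IsChordLog Θ) {X : Type*}
    [TopologicalSpace X] {S : Set X} {f g : X → ℝ} (hf : ContinuousOn f S) (hg : ContinuousOn g S)
    (h1 : ∀ x ∈ S, f x < g x) (h2 : ∀ x ∈ S, g x < f x + n) :
    ContinuousOn (fun x => Θ (f x) (g x)) S :=
  hΘ.continuousOn.comp (hf.prodMk hg) fun x hx => ⟨h1 x hx, h2 x hx⟩

/-- Exchanging the ends of a chord adds `π i` to its logarithm, up to a constant multiple
of `2 π i`. -/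
theorem IsChordLog.exists_swap {Θ : ℝ → ℝ → ℂ} (hΘ : P.IsChordLog Θ) :
    ∃ k : ℤ, ∀ {a b : ℝ}, a < b → b < a + n →
      Θ b (a + n) = Θ a b + Real.pi * Complex.I + k * (2 * Real.pi * Complex.I) := by
  have hn := natCast_pos n
  have hc : ContinuousOn (fun x : ℝ × ℝ => Θ x.2 (x.1 + n)) (paramPairs n) :=
    hΘ.continuousOn_comp continuousOn_snd (continuousOn_fst.add continuousOn_const)
      (fun x hx => hx.2) fun x hx => by linarith [hx.1]
  have hexp : ∀ x ∈ paramPairs n, Complex.exp (Θ x.2 (x.1 + n)) = -1 * Complex.exp (Θ x.1 x.2) :=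
    fun x hx => by
      rw [hΘ.exp_eq hx.1 hx.2, hΘ.exp_eq hx.2 (by linarith [hx.1]), param_add_n]
      ring
  have h0 : ((0 : ℝ), (n : ℝ) / 2) ∈ paramPairs n := by constructor <;> simp only <;> linarith
  have h1 := hexp _ h0
  rw [← Complex.exp_pi_mul_I, ← Complex.exp_add, Complex.exp_eq_exp_iff_exists_int] at h1
  obtain ⟨k, hk⟩ := h1
  refine ⟨k, fun {a b} hab hb => ?_⟩
  have := Complex.sub_eq_sub_of_exp_eq_mul (convex_paramPairs n).isPreconnected hc
    hΘ.continuousOn hexp (x := (a, b)) ⟨hab, hb⟩ h0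
  simp only at this hk
  linear_combination this + hk

end Polygon

/-! ### Winding numbers. -/

namespace Polygon

variable {n : ℕ} [NeZero n] {P : Polygon ℂ n}

theorem HasWindingNumberAbout.notMem_range {z : ℂ} {m : ℤ} (h : P.HasWindingNumberAbout z m) :
    z ∉ Set.range P.param := by
  rintro ⟨t, rfl⟩
  obtain ⟨L, -, hL, -⟩ := h
  exact Complex.exp_ne_zero (L t) (by rw [hL, sub_self])

theorem int_mul_two_pi_I_injective {m m' : ℤ}
    (h : (m : ℂ) * (2 * Real.pi * Complex.I) = m' * (2 * Real.pi * Complex.I)) : m = m' := by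
  exact_mod_cast mul_right_cancel₀ Complex.two_pi_I_ne_zero h

theorem HasWindingNumberAbout.unique {z : ℂ} {m m' : ℤ} (h : P.HasWindingNumberAbout z m)
    (h' : P.HasWindingNumberAbout z m') : m = m' := by
  obtain ⟨L, hL, he, hp⟩ := h
  obtain ⟨L', hL', he', hp'⟩ := h'
  have := Complex.sub_eq_sub_of_exp_eq_mul (c := 1) isPreconnected_univ hL.continuousOn
    hL'.continuousOn (fun t _ => by rw [he, he', one_mul]) (Set.mem_univ (0 + (n : ℝ)))
    (Set.mem_univ 0)
  rw [hp, hp'] at this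
  exact int_mul_two_pi_I_injective (by linear_combination this)

theorem exists_hasWindingNumberAbout {z : ℂ} (hz : z ∉ Set.range P.param) :
    ∃ m, P.HasWindingNumberAbout z m := by
  have hs : IsSimplyConnected (Set.univ : Set ℝ) :=
    have : ContractibleSpace (Set.univ : Set ℝ) := convex_univ.contractibleSpace ⟨0, trivial⟩
    SimplyConnectedSpace.ofContractible _
  obtain ⟨L, hL, he⟩ := Complex.exists_continuousOn_eqOn_exp_comp hs isOpen_univ
    (g := fun t => P.param t - z) (P.continuous_param.sub continuous_const).continuousOn
    (by rintro ⟨t, -, h⟩; exact hz ⟨t, sub_eq_zero.1 h⟩)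
  have he : ∀ t, Complex.exp (L t) = P.param t - z := fun t => he (Set.mem_univ t)
  have hL := continuousOn_univ.1 hL
  have hLn : Continuous fun t => L (t + n) := hL.comp (continuous_id.add continuous_const)
  have heq : ∀ t, Complex.exp (L (t + n)) = Complex.exp (L t) := fun t => by
    rw [he, he, param_add_n]
  obtain ⟨m, hm⟩ := Complex.exp_eq_exp_iff_exists_int.1 (heq 0)
  refine ⟨m, L, hL, he, fun t => ?_⟩
  have := Complex.sub_eq_sub_of_exp_eq_mul (c := 1) isPreconnected_univ hLn.continuousOn
    hL.continuousOn (fun t _ => by rw [heq, one_mul]) (Set.mem_univ t) (Set.mem_univ 0)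
  linear_combination this + hm

theorem one_sub_mem_slitPlane {w : ℂ} (h : ‖w‖ < 1) : 1 - w ∈ Complex.slitPlane := by
  simpa [sub_eq_add_neg] using Complex.mem_slitPlane_of_norm_lt_one (z := -w) (by simpa using h)

/-- The winding number does not change when the base point moves by less than its distance to
the curve. -/
theorem HasWindingNumberAbout.of_norm_lt {z w : ℂ} {m : ℤ} (h : P.HasWindingNumberAbout z m)
    (hw : ∀ t, ‖w - z‖ < ‖P.param t - z‖) : P.HasWindingNumberAbout w m := by
  obtain ⟨L, hL, he, hp⟩ := h
  have hne : ∀ t, P.param t - z ≠ 0 := fun t => norm_pos_iff.1 ((norm_nonneg _).trans_lt (hw t))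
  have hs : ∀ t, 1 - (w - z) / (P.param t - z) ∈ Complex.slitPlane := fun t =>
    one_sub_mem_slitPlane (by rw [norm_div]; exact (div_lt_one (norm_pos_iff.2 (hne t))).2 (hw t))
  -- Factor `γ - w = (γ - z) (1 - (w - z) / (γ - z))`; the second factor stays in the unit disc
  -- about `1`, so its principal logarithm is continuous and periodic.
  refine ⟨fun t => L t + Complex.log (1 - (w - z) / (P.param t - z)), ?_, fun t => ?_, fun t => ?_⟩
  · exact hL.add (Continuous.clog (continuous_const.sub (continuous_const.div
      (P.continuous_param.sub continuous_const) hne)) hs)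
  · rw [Complex.exp_add, he, Complex.exp_log (Complex.slitPlane_ne_zero (hs t)), mul_sub,
      mul_div_cancel₀ _ (hne t)]
    ring
  · simp only [hp, param_add_n]
    ring

/-- Write `γ - z = -z (1 - γ / z)`: the principal logarithm of the second factor is continuous and
periodic. -/
theorem hasWindingNumberAbout_zero_of_norm_lt {z : ℂ} (hz : ∀ t, ‖P.param t‖ < ‖z‖) :
    P.HasWindingNumberAbout z 0 := by
  have hz0 : z ≠ 0 := norm_pos_iff.1 ((norm_nonneg _).trans_lt (hz 0))
  have hs : ∀ t, 1 - P.param t / z ∈ Complex.slitPlane := fun t =>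
    one_sub_mem_slitPlane (by rw [norm_div]; exact (div_lt_one (norm_pos_iff.2 hz0)).2 (hz t))
  refine ⟨fun t => Complex.log (-z) + Complex.log (1 - P.param t / z), ?_, fun t => ?_, fun t => ?_⟩
  · exact continuous_const.add (Continuous.clog (continuous_const.sub
      (P.continuous_param.div_const z)) hs)
  · rw [Complex.exp_add, Complex.exp_log (neg_ne_zero.2 hz0),
      Complex.exp_log (Complex.slitPlane_ne_zero (hs t))]
    field_simp
    ring
  · simp [param_add_n]

theorem isCompact_range_param : IsCompact (Set.range P.param) := by
  have : Set.range P.param = P.param '' Set.Icc 0 (n : ℝ) := by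
    refine Set.Subset.antisymm ?_ (Set.image_subset_range _ _)
    rintro _ ⟨t, rfl⟩
    have hn := natCast_pos n
    refine ⟨toIcoMod hn 0 t, by simpa using Set.Ico_subset_Icc_self (toIcoMod_mem_Ico hn 0 t), ?_⟩
    conv_rhs => rw [← toIcoMod_add_toIcoDiv_zsmul hn 0 t, zsmul_eq_mul, param_add_int_mul]
  rw [this]
  exact isCompact_Icc.image P.continuous_param

theorem isOpen_setOf_hasWindingNumberAbout (m : ℤ) :
    IsOpen {z | P.HasWindingNumberAbout z m} := by
  rw [Metric.isOpen_iff]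
  intro z hz
  obtain ⟨ε, hε, h⟩ := Metric.isOpen_iff.1 isCompact_range_param.isClosed.isOpen_compl z
    (HasWindingNumberAbout.notMem_range hz)
  refine ⟨ε, hε, fun w hw => HasWindingNumberAbout.of_norm_lt hz fun t => ?_⟩
  by_contra! hlt
  exact h (a := P.param t)
    (by rw [Metric.mem_ball, dist_eq_norm] at *; exact hlt.trans_lt hw) ⟨t, rfl⟩

/-- A point about which the curve winds lies in a bounded component of the complement. -/
theorem HasWindingNumberAbout.isBounded_connectedComponentIn {z : ℂ} {m : ℤ}
    (h : P.HasWindingNumberAbout z m) (hm : m ≠ 0) :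
    Bornology.IsBounded (connectedComponentIn (Set.range P.param)ᶜ z) := by
  by_contra hb
  obtain ⟨R, hR⟩ := (P.isCompact_range_param).isBounded.exists_norm_le
  obtain ⟨w, hwC, hw⟩ : ∃ w ∈ connectedComponentIn (Set.range P.param)ᶜ z, R < ‖w‖ := by
    by_contra! hall
    exact hb (isBounded_iff_forall_norm_le.2 ⟨R, hall⟩)
  have hw0 : P.HasWindingNumberAbout w 0 :=
    hasWindingNumberAbout_zero_of_norm_lt fun t => (hR _ ⟨t, rfl⟩).trans_lt hw
  -- An unbounded component would be disconnected by the open sets of zero and of nonzero winding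
  -- number.
  have hV : IsOpen (⋃ m ∈ {m : ℤ | m ≠ 0}, {z | P.HasWindingNumberAbout z m}) :=
    isOpen_biUnion fun m _ => isOpen_setOf_hasWindingNumberAbout m
  obtain ⟨x, -, hx0, hx⟩ := isPreconnected_connectedComponentIn
    (F := (Set.range P.param)ᶜ) (x := z) _ _ (isOpen_setOf_hasWindingNumberAbout (P := P) 0) hV
    (fun x hx => by
      obtain ⟨k, hk⟩ := exists_hasWindingNumberAbout (connectedComponentIn_subset _ _ hx)
      rcases eq_or_ne k 0 with rfl | h0
      · exact Or.inl hk
      · exact Or.inr (Set.mem_biUnion h0 hk))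
    ⟨w, hwC, hw0⟩
    ⟨z, mem_connectedComponentIn h.notMem_range, Set.mem_biUnion hm h⟩
  obtain ⟨k, hk, hxk⟩ := Set.mem_iUnion₂.1 hx
  exact hk (HasWindingNumberAbout.unique hxk hx0)

theorem IsCounterclockwise.eq_one (hor : P.IsCounterclockwise) {z : ℂ} {m : ℤ}
    (h : P.HasWindingNumberAbout z m) (hm : m ≠ 0) : m = 1 :=
  h.unique (hor z h.notMem_range (h.isBounded_connectedComponentIn hm))

/-! ### Winding numbers beside an edge, and the swap constant. -/

theorem log_one_sub_sub_log_neg_one_sub {η : ℝ} (hη : 0 < η) :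
    Complex.log (1 - 2 * η * Complex.I) - Complex.log (-1 - 2 * η * Complex.I) =
      Complex.log (1 - 2 * η * Complex.I) - Complex.log (1 + 2 * η * Complex.I)
        + Real.pi * Complex.I := by
  have h1 : (-1 - 2 * η * Complex.I) = -(1 + 2 * η * Complex.I) := by ring
  rw [h1, Complex.log, Complex.log, Complex.log, norm_neg,
    Complex.arg_neg_eq_arg_sub_pi_of_im_pos (by simpa using hη)]
  push_cast
  ring

theorem log_one_add_sub_log_neg_one_add {η : ℝ} (hη : 0 < η) :
    Complex.log (1 + 2 * η * Complex.I) - Complex.log (-1 + 2 * η * Complex.I) =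
      Complex.log (1 + 2 * η * Complex.I) - Complex.log (1 - 2 * η * Complex.I)
        - Real.pi * Complex.I := by
  have h1 : (-1 + 2 * η * Complex.I) = -(1 - 2 * η * Complex.I) := by ring
  rw [h1, Complex.log, Complex.log, Complex.log, norm_neg,
    Complex.arg_neg_eq_arg_add_pi_of_im_neg (by simpa using hη)]
  push_cast
  ring

theorem param_of_mem_Icc_zero_one {t : ℝ} (h0 : 0 ≤ t) (h1 : t ≤ 1) :
    P.param t = P.param 0 + t * (P.param 1 - P.param 0) := by
  have := P.param_eq_lineMap 0 (t := t) (by simpa using ⟨h0, h1⟩)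
  simp only [AffineMap.lineMap_apply, zero_add, Int.cast_zero, Int.cast_one, sub_zero, vsub_eq_sub,
    vadd_eq_add, Complex.real_smul] at this
  rw [this]
  ring

variable {Θ : ℝ → ℝ → ℂ} {k : ℤ}

/-- The logarithm of the chords from the midpoint of the first edge to the rest of the polygon
changes by `π i` from one end of that edge to the other, up to the constant of `exists_swap`. -/
theorem IsChordLog.sub_half (hn : 2 ≤ n) (hΘ : P.IsChordLog Θ)
    (hk : ∀ {a b : ℝ}, a < b → b < a + n →
      Θ b (a + n) = Θ a b + Real.pi * Complex.I + k * (2 * Real.pi * Complex.I)) :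
    Θ (1 / 2) n - Θ (1 / 2) 1 = Real.pi * Complex.I + k * (2 * Real.pi * Complex.I) := by
  have hn' : (2 : ℝ) ≤ n := by exact_mod_cast hn
  have h1 := hk (a := 0) (b := 1 / 2) (by norm_num) (by linarith)
  have h5 : Θ 0 (0 + 1 / 2) = Θ (1 / 2) (1 / 2 + 1 / 2) :=
    Complex.eq_of_exp_eq_const (S := Set.Icc (0 : ℝ) (1 / 2)) isPreconnected_Icc
      (f := fun r => Θ r (r + 1 / 2)) (c := (P.param 1 - P.param 0) / 2)
      (hΘ.continuousOn_comp continuousOn_id (continuousOn_id.add continuousOn_const)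
        (fun x _ => by linarith) fun x _ => by linarith)
      (fun r hr => by
        rw [hΘ.exp_eq (by linarith) (by linarith),
          param_of_mem_Icc_zero_one (t := r) hr.1 (by linarith [hr.2]),
          param_of_mem_Icc_zero_one (t := r + 1 / 2) (by linarith [hr.1]) (by linarith [hr.2])]
        push_cast
        ring) (by norm_num) (by norm_num)
  rw [zero_add] at h1 h5
  rw [show (1 / 2 + 1 / 2 : ℝ) = 1 by norm_num] at h5
  linear_combination h1 + h5

/-- The base point lies beside the midpoint of the first edge, on its left when `η > 0`. Along the
rest of the curve its logarithm follows that of the chords from the midpoint, which `sub_half`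
evaluates; along the edge it is a principal logarithm. The correction terms cancel, and `hm` says
that the edge contributes `π i` if `m = k + 1` and `-π i` if `m = k`. -/
theorem IsChordLog.hasWindingNumberAbout_of_near (hn : 2 ≤ n) (hP : P.IsSimple)
    (hΘ : P.IsChordLog Θ)
    (hk : ∀ {a b : ℝ}, a < b → b < a + n →
      Θ b (a + n) = Θ a b + Real.pi * Complex.I + k * (2 * Real.pi * Complex.I))
    {η : ℝ} (hη : η ≠ 0)
    (hc : ∀ t ∈ Set.Icc (1 : ℝ) n,
      ‖η * Complex.I * (P.param 1 - P.param 0)‖ < ‖P.param t - P.param (1 / 2)‖)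
    {m : ℤ} (hm : Complex.log (1 - 2 * η * Complex.I) - Complex.log (-1 - 2 * η * Complex.I) =
      Complex.log (1 - 2 * η * Complex.I) - Complex.log (1 + 2 * η * Complex.I)
        + (2 * (m - k) - 1) * (Real.pi * Complex.I)) :
    P.HasWindingNumberAbout
      (P.param (1 / 2) + η * Complex.I * (P.param 1 - P.param 0)) m := by
  have hn' : (2 : ℝ) ≤ n := by exact_mod_cast hn
  set d := P.param 1 - P.param 0 with hd
  set c := η * Complex.I * d with hcdef
  have hd0 : d ≠ 0 := sub_ne_zero.2 (hP.param_ne (by norm_num) (by linarith)).symm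
  have hhalf : P.param (1 / 2) = P.param 0 + d / 2 := by
    rw [param_of_mem_Icc_zero_one (by norm_num) (by norm_num), ← hd]
    push_cast
    ring
  have hedge : ∀ t ∈ Set.Icc (n : ℝ) (n + 1),
      P.param t - (P.param (1 / 2) + c) = d / 2 * ((2 * (t - n) - 1 : ℝ) - 2 * η * Complex.I) :=
    fun t ht => by
      have h := P.param_add_n (t - n)
      rw [sub_add_cancel] at h
      rw [h, param_of_mem_Icc_zero_one (by linarith [ht.1]) (by linarith [ht.2]), hhalf, ← hd]
      push_cast
      rw [hcdef]
      ring
  have hslit : ∀ x : ℝ, ((x : ℂ) - 2 * η * Complex.I) ∈ Complex.slitPlane := fun x =>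
    Complex.mem_slitPlane_iff.2 (Or.inr (by simpa using hη))
  have hfar : ∀ t ∈ Set.Icc (1 : ℝ) n, P.param t - P.param (1 / 2) ≠ 0 := fun t ht =>
    norm_pos_iff.1 ((norm_nonneg _).trans_lt (hc t ht))
  have hslit' : ∀ t ∈ Set.Icc (1 : ℝ) n,
      1 - c / (P.param t - P.param (1 / 2)) ∈ Complex.slitPlane := fun t ht =>
    one_sub_mem_slitPlane
      (by rw [norm_div]; exact (div_lt_one (norm_pos_iff.2 (hfar t ht))).2 (hc t ht))
  have hz : P.param (1 / 2) + c ∉ Set.range P.param := by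
    rintro ⟨t, ht⟩
    -- In the period starting at `1`, the first edge is the last unit interval `[n, n + 1]`.
    obtain ⟨u, hu, hut⟩ : ∃ u ∈ Set.Ico (1 : ℝ) (1 + n), P.param u = P.param t := by
      have hn0 := natCast_pos n
      refine ⟨toIcoMod hn0 1 t, toIcoMod_mem_Ico hn0 1 t, ?_⟩
      conv_rhs => rw [← toIcoMod_add_toIcoDiv_zsmul hn0 1 t, zsmul_eq_mul, param_add_int_mul]
    rw [← hut] at ht
    rcases le_total u n with h | h
    · have := hc u ⟨hu.1, h⟩
      rw [ht, add_sub_cancel_left] at this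
      exact lt_irrefl _ this
    · have := hedge u ⟨h, by linarith [hu.2]⟩
      rw [ht, sub_self] at this
      exact mul_ne_zero (div_ne_zero hd0 two_ne_zero) (Complex.slitPlane_ne_zero (hslit _))
        this.symm
  obtain ⟨m', hm'⟩ := exists_hasWindingNumberAbout hz
  suffices m' = m by rwa [← this]
  obtain ⟨L, hL, he, hp⟩ := hm'
  have e1 := Complex.sub_eq_sub_of_exp_eq_mul (c := 1) (S := Set.Icc (1 : ℝ) n) isPreconnected_Icc
    (f := L) (g := fun t => Θ (1 / 2) t + Complex.log (1 - c / (P.param t - P.param (1 / 2))))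
    hL.continuousOn
    ((hΘ.continuousOn_comp continuousOn_const continuousOn_id
      (fun t ht => by simp only [id]; linarith [ht.1])
      (fun t ht => by simp only [id]; linarith [ht.2])).add
      (ContinuousOn.clog (continuousOn_const.sub (continuousOn_const.div
        (P.continuous_param.sub continuous_const).continuousOn hfar)) hslit'))
    (fun t ht => by
      rw [he, Complex.exp_add, hΘ.exp_eq (by linarith [ht.1]) (by linarith [ht.2]),
        Complex.exp_log (Complex.slitPlane_ne_zero (hslit' t ht)), mul_sub,
        mul_div_cancel₀ _ (hfar t ht)]
      ring)
    (x := (n : ℝ)) (y := 1) ⟨by linarith, le_rfl⟩ ⟨le_rfl, by linarith⟩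
  have e2 := Complex.sub_eq_sub_of_exp_eq_mul (c := d / 2) (S := Set.Icc (n : ℝ) (n + 1))
    isPreconnected_Icc (f := L)
    (g := fun t => Complex.log ((2 * (t - n) - 1 : ℝ) - 2 * η * Complex.I))
    hL.continuousOn
    (ContinuousOn.clog (by fun_prop) (fun t _ => hslit _))
    (fun t ht => by
      rw [he, hedge t ht, Complex.exp_log (Complex.slitPlane_ne_zero (hslit _))])
    (x := (n : ℝ) + 1) (y := n) ⟨by linarith, le_rfl⟩ ⟨le_rfl, by linarith⟩
  have e3 := hp 1
  rw [add_comm] at e3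
  have e4 := hΘ.sub_half hn hk
  have en : c / (P.param n - P.param (1 / 2)) = - (2 * η * Complex.I) := by
    have := P.param_add_n 0
    rw [zero_add] at this
    rw [this, hhalf, show P.param 0 - (P.param 0 + d / 2) = -(d / 2) by ring, hcdef]
    field_simp
  have e5 : c / (P.param 1 - P.param (1 / 2)) = 2 * η * Complex.I := by
    rw [hhalf, show P.param 1 - (P.param 0 + d / 2) = d / 2 by rw [hd]; ring, hcdef]
    field_simp
  simp only [en, e5, sub_neg_eq_add] at e1
  have e6 : ((2 * ((n : ℝ) + 1 - n) - 1 : ℝ) : ℂ) = 1 := by push_cast; ring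
  have e7 : ((2 * ((n : ℝ) - n) - 1 : ℝ) : ℂ) = -1 := by push_cast; ring
  simp only [e6, e7] at e2
  exact int_mul_two_pi_I_injective (by linear_combination e1 + e2 - e3 + e4 + hm)

/-- Exchanging the ends of a chord of a counterclockwise polygon adds `π i` to its logarithm. -/
theorem IsChordLog.swap_of_isCounterclockwise (hn : 2 ≤ n) (hP : P.IsSimple)
    (hor : P.IsCounterclockwise) (hΘ : P.IsChordLog Θ) {a b : ℝ} (hab : a < b) (hb : b < a + n) :
    Θ b (a + n) = Θ a b + Real.pi * Complex.I := by
  obtain ⟨k, hk⟩ := hΘ.exists_swap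
  have hn' : (2 : ℝ) ≤ n := by exact_mod_cast hn
  have hd0 : 0 < ‖P.param 1 - P.param 0‖ :=
    norm_pos_iff.2 (sub_ne_zero.2 (hP.param_ne (by norm_num) (by linarith)).symm)
  obtain ⟨t₀, ht₀, hmin⟩ := (isCompact_Icc (a := (1 : ℝ)) (b := n)).exists_isMinOn
    ⟨1, le_rfl, by linarith⟩
    (f := fun t => ‖P.param t - P.param (1 / 2)‖)
    (P.continuous_param.sub continuous_const).norm.continuousOn
  have hpos : 0 < ‖P.param t₀ - P.param (1 / 2)‖ :=
    norm_pos_iff.2 (sub_ne_zero.2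
      (hP.param_ne (by linarith [ht₀.1]) (by linarith [ht₀.2])).symm)
  obtain ⟨η, hη, hlt⟩ : ∃ η : ℝ, 0 < η ∧
      η * ‖P.param 1 - P.param 0‖ < ‖P.param t₀ - P.param (1 / 2)‖ := by
    refine ⟨‖P.param t₀ - P.param (1 / 2)‖ / 2 / ‖P.param 1 - P.param 0‖, by positivity, ?_⟩
    rw [div_mul_cancel₀ _ hd0.ne']
    linarith
  have hc : ∀ t ∈ Set.Icc (1 : ℝ) n, η * ‖P.param 1 - P.param 0‖ < ‖P.param t - P.param (1 / 2)‖ :=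
    fun t ht => hlt.trans_le (hmin ht)
  have w1 := hΘ.hasWindingNumberAbout_of_near hn hP hk hη.ne' (m := k + 1)
    (fun t ht => by simpa [abs_of_pos hη] using hc t ht)
    (by rw [log_one_sub_sub_log_neg_one_sub hη]; push_cast; ring)
  have w0 := hΘ.hasWindingNumberAbout_of_near hn hP hk (neg_ne_zero.2 hη.ne') (m := k)
    (fun t ht => by simpa [abs_of_pos hη] using hc t ht)
    (by
      have := log_one_add_sub_log_neg_one_add hη
      push_cast
      simp only [mul_neg, neg_mul, sub_neg_eq_add, ← sub_eq_add_neg]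
      rw [this]
      ring)
  -- Both `k` (right of the edge) and `k + 1` (left of it) are winding numbers, hence `0` or `1`.
  have hk0 : k = 0 := by
    by_contra h
    have h1 := hor.eq_one w0 h
    have h2 := hor.eq_one w1 (by omega)
    omega
  rw [hk hab hb, hk0]
  simp

end Polygon

/-! ### The turn at a lowest point. -/

/-- On a longer interval `sin t` and `sin (t + π) = -sin t` would both be nonnegative for a whole
range of `t`, so the sine would vanish at two points less than `π` apart. -/
theorem Real.sub_le_pi_of_sin_nonneg {x y : ℝ} (h : ∀ t ∈ Set.Icc x y, 0 ≤ Real.sin t) :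
    y - x ≤ Real.pi := by
  by_contra! hlt
  have hpi := Real.pi_gt_three
  have hzero : ∀ t, x ≤ t → t + Real.pi ≤ y → Real.sin t = 0 := fun t h1 h2 => by
    have ha := h t ⟨h1, by linarith⟩
    have hb := h (t + Real.pi) ⟨by linarith, h2⟩
    rw [Real.sin_add_pi] at hb
    linarith
  obtain ⟨ε, hε, hε1, hε2⟩ : ∃ ε : ℝ, 0 < ε ∧ ε < Real.pi ∧ x + ε + Real.pi ≤ y :=
    ⟨min 1 (y - x - Real.pi), lt_min one_pos (by linarith),
      (min_le_left _ _).trans_lt (by linarith), by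
        linarith [min_le_right 1 (y - x - Real.pi)]⟩
  have h1 := hzero x le_rfl (by linarith)
  have h2 := hzero (x + ε) (by linarith) hε2
  rw [Real.sin_add, h1, zero_mul, zero_add] at h2
  have h3 := Real.sin_pos_of_pos_of_lt_pi hε hε1
  have h4 := Real.sin_sq_add_cos_sq x
  rcases mul_eq_zero.1 h2 with h | h
  · rw [h1, h] at h4
    norm_num at h4
  · exact h3.ne' h

/-- A continuous function with negative sine keeps its sign. -/
theorem Real.neg_of_sin_neg {f : ℝ → ℝ} (hf : Continuous f) (h : ∀ s, Real.sin (f s) < 0)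
    {a : ℝ} (ha : f a ≤ 0) (b : ℝ) : f b < 0 := by
  by_contra! hb
  obtain ⟨c, hc⟩ := mem_range_of_exists_le_of_exists_ge hf ⟨a, ha⟩ ⟨b, hb⟩
  have := h c
  rw [hc, Real.sin_zero] at this
  exact lt_irrefl _ this

namespace Polygon

variable {n : ℕ} [NeZero n] {P : Polygon ℂ n} {Θ : ℝ → ℝ → ℂ}

/-- At a lowest point `γ t₁`, the polygon turns left from the chord arriving from `γ t₂` to the
chord leaving for `γ t₀`. -/
theorem IsChordLog.im_le_im_of_forall_im_le (hΘ : P.IsChordLog Θ)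
    (hswap : ∀ {a b : ℝ}, a < b → b < a + n → Θ b (a + n) = Θ a b + Real.pi * Complex.I)
    {t₂ t₁ t₀ : ℝ} (h21 : t₂ < t₁) (h10 : t₁ < t₀) (h02 : t₀ < t₂ + n)
    (hlow : ∀ t, (P.param t₁).im ≤ (P.param t).im) : (Θ t₂ t₁).im ≤ (Θ t₁ t₀).im := by
  have hc : ContinuousOn (fun b => (Θ t₁ b).im) (Set.Icc t₀ (t₂ + n)) :=
    Complex.continuous_im.comp_continuousOn (hΘ.continuousOn_comp continuousOn_const continuousOn_id
      (fun b hb => h10.trans_le hb.1) fun b hb => hb.2.trans_lt (by linarith))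
  have hsin : ∀ b ∈ Set.Icc t₀ (t₂ + n), 0 ≤ Real.sin (Θ t₁ b).im := fun b hb => by
    have h := congrArg Complex.im
      (hΘ.exp_eq (a := t₁) (b := b) (h10.trans_le hb.1) (hb.2.trans_lt (by linarith)))
    rw [Complex.exp_im, Complex.sub_im] at h
    exact nonneg_of_mul_nonneg_right (h ▸ sub_nonneg.2 (hlow b)) (Real.exp_pos _)
  -- All chords from the lowest point point weakly upwards, and by the intermediate value theorem
  -- they attain every angle between the two extreme ones.
  have hs := Real.sub_le_pi_of_sin_nonneg (x := (Θ t₁ t₀).im) (y := (Θ t₁ (t₂ + n)).im)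
    fun y hy => by
      obtain ⟨b, hb, rfl⟩ := intermediate_value_Icc h02.le hc hy
      exact hsin b hb
  rw [hswap h21 (by linarith)] at hs
  simp at hs
  linarith

theorem exists_forall_im_le (P : Polygon ℂ n) : ∃ t₀, ∀ t, (P.param t₀).im ≤ (P.param t).im := by
  obtain ⟨_, ⟨t₀, rfl⟩, h⟩ := (isCompact_range_param (P := P)).exists_isMinOn
    (Set.range_nonempty _) Complex.continuous_im.continuousOn
  exact ⟨t₀, fun t => h ⟨t, rfl⟩⟩

/-! ### Lifts of the vertices and the three turns of a triangle. -/

/-- A lift of nonzero degree is surjective. -/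
theorem surjective_of_add_one {τ : ℝ → ℝ} (hτ : Continuous τ) {m : ℤ} (hm : m ≠ 0)
    (h : ∀ s, τ (s + 1) = τ s + m * n) : Function.Surjective τ := by
  have hn := natCast_pos n
  have hz : ∀ j : ℤ, τ j = τ 0 + j * (m * n) := fun j => by
    induction j using Int.induction_on with
    | zero => simp
    | succ i ih =>
      push_cast at ih ⊢
      rw [h, ih]
      ring
    | pred i ih =>
      have := h ((-(i : ℤ) - 1 : ℤ) : ℝ)
      push_cast at this ih ⊢
      rw [sub_add_cancel, ih] at this
      linarith
  have hmn : (m : ℝ) * n ≠ 0 := mul_ne_zero (Int.cast_ne_zero.2 hm) hn.ne'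
  intro y
  obtain ⟨p, hp⟩ : ∃ p : ℤ, τ p ≤ y ∧ ∃ q : ℤ, y ≤ τ q := by
    rcases lt_or_gt_of_ne hmn with hneg | hpos
    · refine ⟨⌈(y - τ 0) / (m * n)⌉, ?_, ⌊(y - τ 0) / (m * n)⌋, ?_⟩ <;> rw [hz]
      · linarith [(div_le_iff_of_neg hneg).1 (Int.le_ceil ((y - τ 0) / (m * n)))]
      · linarith [(le_div_iff_of_neg hneg).1 (Int.floor_le ((y - τ 0) / (m * n)))]
    · refine ⟨⌊(y - τ 0) / (m * n)⌋, ?_, ⌈(y - τ 0) / (m * n)⌉, ?_⟩ <;> rw [hz]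
      · linarith [(le_div_iff₀ hpos).1 (Int.floor_le ((y - τ 0) / (m * n)))]
      · linarith [(div_le_iff₀ hpos).1 (Int.le_ceil ((y - τ 0) / (m * n)))]
  obtain ⟨hp, q, hq⟩ := hp
  exact mem_range_of_exists_le_of_exists_ge hτ ⟨p, hp⟩ ⟨q, hq⟩

/-- A continuous function that never vanishes keeps its sign. -/
theorem pos_of_forall_ne_zero {f : ℝ → ℝ} (hf : Continuous f) (h : ∀ s, f s ≠ 0)
    {a : ℝ} (ha : 0 < f a) (b : ℝ) : 0 < f b := by
  by_contra! hb
  obtain ⟨c, hc⟩ := mem_range_of_exists_le_of_exists_ge hf ⟨b, hb⟩ ⟨a, ha.le⟩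
  exact h c hc

/-- The sine of the angle between two vectors, in terms of their logarithms. -/
theorem sin_im_sub_neg {u v : ℂ} (h : ((starRingEnd ℂ) (Complex.exp u) * Complex.exp v).im < 0) :
    Real.sin (v.im - u.im) < 0 := by
  rw [← Complex.exp_conj, ← Complex.exp_add, Complex.exp_im] at h
  have := neg_of_mul_neg_right h (Real.exp_pos _).le
  rwa [Complex.add_im, Complex.conj_im, neg_add_eq_sub] at this

/-- Three points that each run through the whole curve, in the cyclic order `τ₂, τ₁, τ₀`, do not
span counterclockwise triangles `τ₀, τ₁, τ₂` all the time. -/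
theorem IsChordLog.not_forall_isCounterclockwiseTriangle (hΘ : P.IsChordLog Θ)
    (hswap : ∀ {a b : ℝ}, a < b → b < a + n → Θ b (a + n) = Θ a b + Real.pi * Complex.I)
    {τ₂ τ₁ τ₀ : ℝ → ℝ} (c2 : Continuous τ₂) (c1 : Continuous τ₁) (c0 : Continuous τ₀)
    (s2 : Function.Surjective τ₂) (s1 : Function.Surjective τ₁) (s0 : Function.Surjective τ₀)
    (h21 : ∀ s, τ₂ s < τ₁ s) (h10 : ∀ s, τ₁ s < τ₀ s) (h02 : ∀ s, τ₀ s < τ₂ s + n) :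
    ¬ ∀ s, IsCounterclockwiseTriangle ![P.param (τ₀ s), P.param (τ₁ s), P.param (τ₂ s)] := by
  intro hT
  have hT : ∀ s, 0 < ((starRingEnd ℂ) (P.param (τ₁ s) - P.param (τ₀ s))
      * (P.param (τ₂ s) - P.param (τ₀ s))).im := hT
  obtain ⟨t, ht⟩ := P.exists_forall_im_le
  have e1 : ∀ s, Complex.exp (Θ (τ₂ s) (τ₁ s)) = P.param (τ₁ s) - P.param (τ₂ s) := fun s =>
    hΘ.exp_eq (h21 s) (by linarith [h10 s, h02 s])
  have e0 : ∀ s, Complex.exp (Θ (τ₁ s) (τ₀ s)) = P.param (τ₀ s) - P.param (τ₁ s) := fun s =>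
    hΘ.exp_eq (h10 s) (by linarith [h21 s, h02 s])
  have e2 : ∀ s, Complex.exp (Θ (τ₀ s) (τ₂ s + n)) = P.param (τ₂ s) - P.param (τ₀ s) := fun s => by
    rw [hΘ.exp_eq (h02 s) (by linarith [h21 s, h10 s]), param_add_n]
  have k1 : Continuous fun s => (Θ (τ₂ s) (τ₁ s)).im :=
    Complex.continuous_im.comp (continuousOn_univ.1 (hΘ.continuousOn_comp c2.continuousOn
      c1.continuousOn (fun s _ => h21 s) fun s _ => by linarith [h10 s, h02 s]))
  have k0 : Continuous fun s => (Θ (τ₁ s) (τ₀ s)).im :=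
    Complex.continuous_im.comp (continuousOn_univ.1 (hΘ.continuousOn_comp c1.continuousOn
      c0.continuousOn (fun s _ => h10 s) fun s _ => by linarith [h21 s, h02 s]))
  have k2 : Continuous fun s => (Θ (τ₀ s) (τ₂ s + n)).im :=
    Complex.continuous_im.comp (continuousOn_univ.1 (hΘ.continuousOn_comp c0.continuousOn
      (c2.add continuous_const).continuousOn (fun s _ => h02 s)
      fun s _ => by linarith [h21 s, h10 s]))
  -- Two swaps make a full turn, so the three turns below telescope to `2 π`.
  have hfull : ∀ s, (Θ (τ₂ s + n) (τ₁ s + n)).im = (Θ (τ₂ s) (τ₁ s)).im + 2 * Real.pi := fun s => by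
    rw [hswap (a := τ₁ s) (b := τ₂ s + n) (by linarith [h10 s, h02 s]) (by linarith [h21 s]),
      hswap (h21 s) (by linarith [h10 s, h02 s])]
    simp
    ring
  have n1 : ∀ s, Real.sin ((Θ (τ₁ s) (τ₀ s)).im - (Θ (τ₂ s) (τ₁ s)).im) < 0 := fun s =>
    sin_im_sub_neg (by
      rw [e1, e0]
      have := hT s
      simp at this ⊢
      linarith)
  have n0 : ∀ s, Real.sin ((Θ (τ₀ s) (τ₂ s + n)).im - (Θ (τ₁ s) (τ₀ s)).im) < 0 := fun s =>
    sin_im_sub_neg (by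
      rw [e0, e2]
      have := hT s
      simp at this ⊢
      linarith)
  have n2 : ∀ s, Real.sin ((Θ (τ₂ s) (τ₁ s)).im + 2 * Real.pi - (Θ (τ₀ s) (τ₂ s + n)).im) < 0 :=
    fun s => by
      rw [add_sub_right_comm, Real.sin_add_two_pi]
      exact sin_im_sub_neg (by
        rw [e1, e2]
        have := hT s
        simp at this ⊢
        linarith)
  have hpi := Real.pi_pos
  have hbig : ∀ x : ℝ, 0 < x → Real.sin x < 0 → Real.pi < x := fun x hx h => by
    by_contra! hle
    exact (Real.sin_nonneg_of_nonneg_of_le_pi hx.le hle).not_gt h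
  -- A turn that is nonpositive at `s = 0` contradicts the lowest point; if there is none, the three
  -- turns sum to more than `3 π`.
  by_cases p1 : (Θ (τ₁ 0) (τ₀ 0)).im - (Θ (τ₂ 0) (τ₁ 0)).im ≤ 0
  · obtain ⟨s, hs⟩ := s1 t
    refine (Real.neg_of_sin_neg (k0.sub k1) n1 p1 s).not_ge (sub_nonneg.2 ?_)
    exact hΘ.im_le_im_of_forall_im_le hswap (h21 s) (h10 s) (h02 s) (by rwa [hs])
  by_cases p0 : (Θ (τ₀ 0) (τ₂ 0 + n)).im - (Θ (τ₁ 0) (τ₀ 0)).im ≤ 0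
  · obtain ⟨s, hs⟩ := s0 t
    refine (Real.neg_of_sin_neg (k2.sub k0) n0 p0 s).not_ge (sub_nonneg.2 ?_)
    exact hΘ.im_le_im_of_forall_im_le hswap (h10 s) (h02 s) (by linarith [h21 s]) (by rwa [hs])
  by_cases p2 : (Θ (τ₂ 0) (τ₁ 0)).im + 2 * Real.pi - (Θ (τ₀ 0) (τ₂ 0 + n)).im ≤ 0
  · obtain ⟨s, hs⟩ := s2 t
    refine (Real.neg_of_sin_neg ((k1.add continuous_const).sub k2) n2 p2 s).not_ge (sub_nonneg.2 ?_)
    have := hΘ.im_le_im_of_forall_im_le hswap (h02 s) (t₀ := τ₁ s + n) (by linarith [h21 s])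
      (by linarith [h10 s]) (by rwa [param_add_n, hs])
    rwa [hfull] at this
  · have := hbig _ (not_le.1 p1) (n1 0)
    have := hbig _ (not_le.1 p0) (n0 0)
    have := hbig _ (not_le.1 p2) (n2 0)
    linarith

end Polygon

theorem mainTheorem10 (n : ℕ) [NeZero n] (hn : 3 ≤ n) (P : Polygon ℂ n)
    (hP : P.IsSimple) (hor : P.IsCounterclockwise) :
    ¬ ∃ T : UnitAddCircle → Fin 3 → ℂ, P.IsEssentialUngracefulLoop T := by
  rintro ⟨T, hT⟩
  obtain ⟨Θ, hΘ⟩ := hP.exists_isChordLog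
  have hswap : ∀ {a b : ℝ}, a < b → b < a + n → Θ b (a + n) = Θ a b + Real.pi * Complex.I :=
    hΘ.swap_of_isCounterclockwise (by omega) hP hor
  obtain ⟨-, t, htT, h21, h10, h02⟩ := hT.ungraceful ((0 : ℝ) : UnitAddCircle)
  have hlift : ∀ k, ∃ τ : ℝ → ℝ, Continuous τ ∧ Function.Surjective τ ∧ τ 0 = t k ∧
      ∀ s : ℝ, P.param (τ s) = T s k := fun k => by
    obtain ⟨m, hm, τ, hc, hτ, hp⟩ := hT.essential k
    obtain ⟨j, hj⟩ := hP.exists_eq_add ((hτ 0).trans (htT k).symm)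
    -- Shifting by whole periods makes the lifts start at the ordered parameters `t k`.
    refine ⟨fun s => τ s + j * n, hc.add continuous_const, fun y => ?_, hj.symm, fun s => ?_⟩
    · obtain ⟨s, hs⟩ := Polygon.surjective_of_add_one hc hm hp (y - j * n)
      exact ⟨s, by simp [hs]⟩
    · rw [Polygon.param_add_int_mul, hτ]
  choose τ hc hsurj h0 hτ using hlift
  have htri : ∀ s : ℝ, Polygon.IsCounterclockwiseTriangle
      ![P.param (τ 0 s), P.param (τ 1 s), P.param (τ 2 s)] := fun s => by
    rw [hτ, hτ, hτ]
    exact (hT.ungraceful s).1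
  have htri' : ∀ s : ℝ, 0 < ((starRingEnd ℂ) (P.param (τ 1 s) - P.param (τ 0 s))
      * (P.param (τ 2 s) - P.param (τ 0 s))).im := htri
  have ne21 : ∀ s, P.param (τ 1 s) ≠ P.param (τ 2 s) := fun s h => by
    have := htri' s
    rw [h, mul_comm, Complex.mul_conj, Complex.ofReal_im] at this
    exact lt_irrefl _ this
  have ne10 : ∀ s, P.param (τ 0 s) ≠ P.param (τ 1 s) := fun s h => by
    simpa [h] using htri' s
  have ne02 : ∀ s, P.param (τ 2 s) ≠ P.param (τ 0 s) := fun s h => by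
    simpa [h] using htri' s
  -- The order of the lifts persists from `s = 0`, since the vertices of a nondegenerate triangle
  -- never collide.
  refine hΘ.not_forall_isCounterclockwiseTriangle hswap (hc 2) (hc 1) (hc 0) (hsurj 2) (hsurj 1) (hsurj 0)
    (fun s => ?_) (fun s => ?_) (fun s => ?_) htri
  · refine sub_pos.1 (Polygon.pos_of_forall_ne_zero ((hc 1).sub (hc 2)) (fun s h => ?_)
      (a := 0) (by simpa [h0] using h21) s)
    exact ne21 s (by rw [sub_eq_zero.1 h])
  · refine sub_pos.1 (Polygon.pos_of_forall_ne_zero ((hc 0).sub (hc 1)) (fun s h => ?_)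
      (a := 0) (by simpa [h0] using h10) s)
    exact ne10 s (by rw [sub_eq_zero.1 h])
  · refine sub_pos.1 (Polygon.pos_of_forall_ne_zero (((hc 2).add continuous_const).sub (hc 0))
      (fun s h => ?_) (a := 0) (by simpa [h0] using h02) s)
    have h : τ 2 s + n - τ 0 s = 0 := h
    exact ne02 s (by rw [← sub_eq_zero.1 h, Polygon.param_add_n])
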